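/- A *cyclotomic generating function* (CGF) is a nonzero polynomial $f(q)=\sum_{k} c_k q^k$ with nonnegative integer coefficients all of whose complex roots are either zero or roots of unity. A random variable *corresponds to* $f$ if it takes the value $k$ with probability $c_k/f(1)$ for each integer $k\ge 0$. For a random variable $\mathcal{Y}$ with mean $\mu$ and variance $\sigma^2$, let $\mathcal{Y}^*=(\mathcal{Y}-\mu)/\sigma$ be the standardized random variable, with the convention $\mathcal{Y}^*=0$ if $\sigma=0$, and let $\mu_d^{\mathcal{Y}}=\mathbb{E}[\mathcal{Y}^d]$ be the $d$th moment. A real random variable is *determined by its moments* if its moments of all orders exist and are finite, and every real random variable with the same finite moments has the same distribution. **Theorem.** Suppose $\mathcal{X}_1,\mathcal{X}_2,\ldots$ is a sequence of random variables corresponding to cyclotomic generating functions such that $\mathcal{X}_n^*$ converges in distribution to $\mathcal{X}$ for some real-valued random variable $\mathcal{X}$. Then $\mathcal{X}$ is determined by its moments and, for every integer $d\ge 1$, $$\lim_{n\to\infty}\mu_d^{\mathcal{X}_n^*}=\mu_d^{\mathcal{X}}.$$ -/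

import Mathlib

open MeasureTheory ProbabilityTheory Filter Topology Polynomial

/-- A cyclotomic generating function: a nonzero polynomial with nonnegative integer coefficients
whose complex roots are all either zero or roots of unity. -/
def IsCyclotomicGeneratingFunction (f : ℕ[X]) : Prop :=
  f ≠ 0 ∧ ∀ z : ℂ, aeval z f = 0 → z = 0 ∨ ∃ m : ℕ, 0 < m ∧ z ^ m = 1

/-- The real random variable `Y` on the probability space `(Ω, μ)` corresponds to the polynomial
`f = ∑ c_k q^k`: it satisfies `P(Y = k) = c_k / f(1)` for every natural number `k`. (These
probabilities add up to one, so `Y` is almost surely a natural number.) -/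
def CorrespondsTo {Ω : Type*} [MeasurableSpace Ω] (Y : Ω → ℝ) (f : ℕ[X]) (μ : Measure Ω) : Prop :=
  AEMeasurable Y μ ∧ ∀ k : ℕ, μ.real {ω | Y ω = (k : ℝ)} = (f.coeff k : ℝ) / (f.eval 1 : ℕ)

/-- The standardization `(Y - E Y) / σ`, where `σ` is the standard deviation of `Y`. When `σ = 0`,
it is the zero random variable. -/
noncomputable def standardize {Ω : Type*} [MeasurableSpace Ω] (Y : Ω → ℝ) (μ : Measure Ω) :
    Ω → ℝ :=
  fun ω ↦ (Y ω - ∫ ω', Y ω' ∂μ) / √(variance Y μ)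

/-- `Y` is determined by its moments: it has finite moments of all orders, and every probability
measure on the real line with the same finite moments is the law of `Y`. -/
def IsDeterminedByMoments {Ω : Type*} [MeasurableSpace Ω] (Y : Ω → ℝ) (μ : Measure Ω) : Prop :=
  (∀ d : ℕ, Integrable (fun ω ↦ Y ω ^ d) μ) ∧
    ∀ ν : Measure ℝ, IsProbabilityMeasure ν →
      (∀ d : ℕ, Integrable (fun x : ℝ ↦ x ^ d) ν ∧ ∫ x : ℝ, x ^ d ∂ν = moment Y d μ) →
      ν = μ.map Y

/-!
Let `Y` correspond to `f`, with mean `m` and variance `v`. Factoring `f` over `ℂ` and using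
`|e^s - z|² = e^s (2 (cosh s - 1) + |1 - z|²)` for `|z| = 1`, one finds
`(E e^{s (Y - m)})² = ∏ (1 + 2 v_z (cosh s - 1))`, the product running over the nonzero roots `z`,
where `v_z = 1 / |1 - z|² ≥ 1 / 4` and `v = ∑ v_z`. Hence `E e^{s (Y - m)} ≤ e^{v (cosh s - 1)}`,
and `v` is either zero or at least `1 / 4`; together these bound the exponential moments of the
standardization of `Y` independently of `f`. Such uniform bounds pass to the weak limit, they make
all powers uniformly integrable, and they determine the limit law: its complex moment generating
function is analytic on a strip around the imaginary axis, where its germ at `0`, given by the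
moments, determines it.
-/

/-! ### Weak convergence and integrals of unbounded functions -/

lemma exists_boundedContinuousFunction_abs_sub_le {E : Type*} [TopologicalSpace E] {g : E → ℝ}
    (hg : Continuous g) {c : ℝ} (hc : 0 < c) :
    ∃ φ : BoundedContinuousFunction E ℝ, ∀ x, |g x - φ x| ≤ c * g x ^ 2 := by
  have hden (x : E) : 0 < 1 + (c * g x) ^ 2 := by positivity
  have hamgm (x : E) : c * |g x| ≤ 1 + (c * g x) ^ 2 := by
    rw [mul_pow, ← sq_abs (g x)]
    nlinarith [sq_nonneg (c * |g x| - 1)]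
  refine ⟨.ofNormedAddCommGroup (fun x ↦ g x / (1 + (c * g x) ^ 2))
    (hg.div (by fun_prop) fun x ↦ (hden x).ne') c⁻¹ fun x ↦ ?_, fun x ↦ ?_⟩
  · rw [Real.norm_eq_abs, abs_div, abs_of_pos (hden x), div_le_iff₀ (hden x), inv_mul_eq_div,
      le_div_iff₀' hc]
    exact hamgm x
  · have herror : g x - g x / (1 + (c * g x) ^ 2) =
        c * g x ^ 2 * (c * g x / (1 + (c * g x) ^ 2)) := by
      field_simp [(hden x).ne']
      ring
    rw [BoundedContinuousFunction.coe_ofNormedAddCommGroup, herror, abs_mul,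
      abs_of_nonneg (by positivity : 0 ≤ c * g x ^ 2), abs_div, abs_of_pos (hden x), abs_mul,
      abs_of_pos hc]
    exact mul_le_of_le_one_right (by positivity) ((div_le_one (hden x)).2 (hamgm x))

section WeakConvergence

variable {E ι : Type*} [TopologicalSpace E] [MeasurableSpace E] [OpensMeasurableSpace E]
  {l : Filter ι} {μs : ι → ProbabilityMeasure E} {μ : ProbabilityMeasure E} {B : ℝ}

lemma lintegral_le_of_tendsto [l.NeBot] (hμ : Tendsto μs l (𝓝 μ)) {g : E → NNReal}
    (hg : Continuous g) {b : ENNReal} (hb : ∀ i, ∫⁻ x, g x ∂(μs i : Measure E) ≤ b) :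
    ∫⁻ x, g x ∂(μ : Measure E) ≤ b := by
  have htrunc (n : ℕ) : ∫⁻ x, (min (g x) n : NNReal) ∂(μ : Measure E) ≤ b := by
    let φ : BoundedContinuousFunction E NNReal :=
      .mkOfBound ⟨fun x ↦ min (g x) n, by fun_prop⟩ n fun x y ↦ by
        rw [NNReal.dist_eq]
        exact abs_sub_le_of_nonneg_of_le (by positivity) (mod_cast min_le_right _ _)
          (by positivity) (mod_cast min_le_right _ _)
    refine le_of_tendsto (ProbabilityMeasure.tendsto_iff_forall_lintegral_tendsto.1 hμ φ)
      (.of_forall fun i ↦ (lintegral_mono fun x ↦ ?_).trans (hb i))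
    exact ENNReal.coe_le_coe.2 (min_le_left (g x) n)
  have hsup (x : E) : (g x : ENNReal) = ⨆ n : ℕ, ((min (g x) n : NNReal) : ENNReal) := by
    refine le_antisymm ?_ (iSup_le fun n ↦ mod_cast min_le_left (g x) n)
    obtain ⟨n, hn⟩ := exists_nat_ge (g x)
    exact le_iSup_of_le n (by rw [min_eq_left hn])
  simp_rw [hsup]
  rw [lintegral_iSup (fun n ↦ by fun_prop) fun m n hmn x ↦
    ENNReal.coe_le_coe.2 (min_le_min_left (g x) (Nat.cast_le.2 hmn))]
  exact iSup_le htrunc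

lemma integrable_and_integral_le_of_tendsto [l.NeBot] (hμ : Tendsto μs l (𝓝 μ)) {g : E → ℝ}
    (hg : Continuous g) (hg0 : 0 ≤ g) (hint : ∀ i, Integrable g (μs i : Measure E))
    (hB : ∀ i, ∫ x, g x ∂(μs i : Measure E) ≤ B) :
    Integrable g (μ : Measure E) ∧ ∫ x, g x ∂(μ : Measure E) ≤ B := by
  have hlint : ∫⁻ x, ENNReal.ofReal (g x) ∂(μ : Measure E) ≤ ENNReal.ofReal B := by
    refine lintegral_le_of_tendsto hμ (g := fun x ↦ (g x).toNNReal) (by fun_prop) fun i ↦ ?_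
    change ∫⁻ x, ENNReal.ofReal (g x) ∂(μs i : Measure E) ≤ _
    rw [← ofReal_integral_eq_lintegral_ofReal (hint i) (.of_forall hg0)]
    exact ENNReal.ofReal_le_ofReal (hB i)
  have hB0 : 0 ≤ B := by
    obtain ⟨i⟩ := l.nonempty_of_neBot
    exact (integral_nonneg hg0).trans (hB i)
  refine ⟨⟨hg.aestronglyMeasurable, ?_⟩, ?_⟩
  · rw [hasFiniteIntegral_iff_ofReal (.of_forall hg0)]
    exact hlint.trans_lt ENNReal.ofReal_lt_top
  · rw [integral_eq_lintegral_of_nonneg_ae (.of_forall hg0) hg.aestronglyMeasurable]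
    exact ENNReal.toReal_le_of_le_ofReal hB0 hlint

lemma abs_integral_sub_le_of_abs_sub_le {ν : ProbabilityMeasure E} {g : E → ℝ} (hg : Continuous g)
    (hint : Integrable (fun x ↦ g x ^ 2) (ν : Measure E))
    (hB : ∫ x, g x ^ 2 ∂(ν : Measure E) ≤ B) {φ : BoundedContinuousFunction E ℝ} {c : ℝ}
    (hc : 0 ≤ c) (hφ : ∀ x, |g x - φ x| ≤ c * g x ^ 2) :
    |∫ x, g x ∂(ν : Measure E) - ∫ x, φ x ∂(ν : Measure E)| ≤ c * B := by
  have hg1 : Integrable g (ν : Measure E) :=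
    ((memLp_two_iff_integrable_sq hg.aestronglyMeasurable).2 hint).integrable one_le_two
  calc |∫ x, g x ∂(ν : Measure E) - ∫ x, φ x ∂(ν : Measure E)|
      = |∫ x, (g x - φ x) ∂(ν : Measure E)| := by rw [integral_sub hg1 (φ.integrable _)]
    _ ≤ ∫ x, |g x - φ x| ∂(ν : Measure E) := abs_integral_le_integral_abs
    _ ≤ ∫ x, c * g x ^ 2 ∂(ν : Measure E) :=
      integral_mono (hg1.sub (φ.integrable _)).abs (hint.const_mul c) hφ
    _ ≤ c * B := by
      rw [integral_const_mul]
      gcongr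

lemma tendsto_integral_of_integral_sq_le [l.NeBot] (hμ : Tendsto μs l (𝓝 μ)) {g : E → ℝ}
    (hg : Continuous g) (hint : ∀ i, Integrable (fun x ↦ g x ^ 2) (μs i : Measure E))
    (hB : ∀ i, ∫ x, g x ^ 2 ∂(μs i : Measure E) ≤ B) :
    Tendsto (fun i ↦ ∫ x, g x ∂(μs i : Measure E)) l (𝓝 (∫ x, g x ∂(μ : Measure E))) := by
  obtain ⟨hintμ, hBμ⟩ := integrable_and_integral_le_of_tendsto hμ (g := fun x ↦ g x ^ 2)
    (by fun_prop) (fun x ↦ sq_nonneg (g x)) hint hB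
  have hB0 : 0 ≤ B := (integral_nonneg fun x ↦ sq_nonneg (g x)).trans hBμ
  rw [Metric.tendsto_nhds]
  intro ε hε
  obtain ⟨c, hc, hcε⟩ : ∃ c > 0, c * B < ε / 3 := by
    refine ⟨ε / (3 * (B + 1)), by positivity, ?_⟩
    field_simp
    linarith
  obtain ⟨φ, hφ⟩ := exists_boundedContinuousFunction_abs_sub_le hg hc
  filter_upwards [Metric.tendsto_nhds.1
    (ProbabilityMeasure.tendsto_iff_forall_integral_tendsto.1 hμ φ) (ε / 3) (by positivity)]
    with i hi
  have herri := abs_integral_sub_le_of_abs_sub_le hg (hint i) (hB i) hc.le hφ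
  have herrμ := abs_integral_sub_le_of_abs_sub_le hg hintμ hBμ hc.le hφ
  rw [Real.dist_eq, abs_lt] at hi ⊢
  rw [abs_le] at herri herrμ
  constructor <;> linarith

end WeakConvergence

/-! ### Exponential moments and the moment problem -/

section ExponentialMoments

variable {μ ν : Measure ℝ} {s t : ℝ}

lemma exp_abs_le_two_mul_cosh (x : ℝ) : Real.exp |x| ≤ 2 * Real.cosh x := by
  rw [← Real.cosh_abs, Real.cosh_eq]
  linarith [Real.exp_pos (-|x|)]

lemma pow_two_mul_le_factorial_mul_cosh (x : ℝ) (d : ℕ) :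
    x ^ (2 * d) ≤ (2 * d).factorial * Real.cosh x := by
  rw [← div_le_iff₀' (by positivity)]
  exact le_hasSum (Real.hasSum_cosh x) d fun k _ ↦
    div_nonneg ((even_two_mul k).pow_nonneg x) (by positivity)

lemma integrable_exp_mul_of_integrable_cosh (h : Integrable (fun x ↦ Real.cosh (t * x)) μ)
    (hs : |s| ≤ |t|) : Integrable (fun x ↦ Real.exp (s * x)) μ := by
  refine (h.const_mul 2).mono' (by fun_prop) (.of_forall fun x ↦ ?_)
  rw [Real.norm_of_nonneg (Real.exp_pos _).le]
  refine (Real.exp_le_exp.2 ?_).trans (exp_abs_le_two_mul_cosh (t * x))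
  rw [abs_mul]
  exact (le_abs_self _).trans (by rw [abs_mul]; gcongr)

lemma integrable_pow_of_integrable_cosh (ht : t ≠ 0)
    (h : Integrable (fun x ↦ Real.cosh (t * x)) μ) (d : ℕ) : Integrable (fun x ↦ x ^ d) μ :=
  integrable_pow_of_integrable_exp_mul (X := id) ht
    (integrable_exp_mul_of_integrable_cosh h le_rfl)
    (integrable_exp_mul_of_integrable_cosh h (abs_neg t).le) d

lemma integral_pow_two_mul_le (ht : t ≠ 0) (h : Integrable (fun x ↦ Real.cosh (t * x)) μ)
    (d : ℕ) :
    ∫ x, x ^ (2 * d) ∂μ ≤ (2 * d).factorial / t ^ (2 * d) * ∫ x, Real.cosh (t * x) ∂μ := by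
  have htd : 0 < t ^ (2 * d) := (even_two_mul d).pow_pos ht
  rw [← integral_const_mul]
  refine integral_mono (integrable_pow_of_integrable_cosh ht h _) (h.const_mul _) fun x ↦ ?_
  dsimp only
  rw [div_mul_eq_mul_div, le_div_iff₀' htd, ← mul_pow]
  exact pow_two_mul_le_factorial_mul_cosh (t * x) d

lemma lintegral_cosh_eq_tsum_moments (h : ∀ d : ℕ, Integrable (fun x : ℝ ↦ x ^ d) μ) (t : ℝ) :
    ∫⁻ x, ENNReal.ofReal (Real.cosh (t * x)) ∂μ =
      ∑' k : ℕ, ENNReal.ofReal (t ^ (2 * k) / (2 * k).factorial * ∫ x, x ^ (2 * k) ∂μ) := by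
  have hnonneg (k : ℕ) (x : ℝ) : 0 ≤ t ^ (2 * k) / (2 * k).factorial * x ^ (2 * k) :=
    mul_nonneg (div_nonneg ((even_two_mul k).pow_nonneg t) (by positivity))
      ((even_two_mul k).pow_nonneg x)
  have hseries (x : ℝ) : HasSum (fun k : ℕ ↦ t ^ (2 * k) / (2 * k).factorial * x ^ (2 * k))
      (Real.cosh (t * x)) := by
    simpa only [mul_pow, div_mul_eq_mul_div] using Real.hasSum_cosh (t * x)
  have hpointwise (x : ℝ) : ENNReal.ofReal (Real.cosh (t * x)) =
      ∑' k : ℕ, ENNReal.ofReal (t ^ (2 * k) / (2 * k).factorial * x ^ (2 * k)) := by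
    rw [← (hseries x).tsum_eq, ENNReal.ofReal_tsum_of_nonneg (hnonneg · x) (hseries x).summable]
  simp_rw [hpointwise]
  rw [lintegral_tsum fun k ↦ by fun_prop]
  refine tsum_congr fun k ↦ ?_
  rw [← integral_const_mul, ofReal_integral_eq_lintegral_ofReal ((h _).const_mul _)
    (.of_forall (hnonneg k))]

lemma integrable_cosh_of_moments_eq (ht : t ≠ 0) (h : Integrable (fun x ↦ Real.cosh (t * x)) μ)
    (hν : ∀ d : ℕ, Integrable (fun x : ℝ ↦ x ^ d) ν)
    (hm : ∀ d : ℕ, ∫ x, x ^ d ∂ν = ∫ x, x ^ d ∂μ) :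
    Integrable (fun x ↦ Real.cosh (t * x)) ν := by
  refine ⟨by fun_prop, ?_⟩
  rw [hasFiniteIntegral_iff_ofReal (.of_forall fun x ↦ (Real.cosh_pos _).le),
    lintegral_cosh_eq_tsum_moments hν]
  simp_rw [hm]
  rw [← lintegral_cosh_eq_tsum_moments (integrable_pow_of_integrable_cosh ht h)]
  exact h.lintegral_lt_top

lemma hasSum_complexMGF_of_integrable_cosh {z : ℂ}
    (h : Integrable (fun x ↦ Real.cosh (t * x)) μ) (hz : ‖z‖ ≤ |t|) :
    HasSum (fun k : ℕ ↦ z ^ k / (k.factorial : ℂ) * ((∫ x, x ^ k ∂μ : ℝ) : ℂ))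
      (complexMGF id μ z) := by
  have hexp : Integrable (fun x ↦ Real.exp (‖z‖ * |x|)) μ := by
    refine (h.const_mul 2).mono' (by fun_prop) (.of_forall fun x ↦ ?_)
    rw [Real.norm_of_nonneg (Real.exp_pos _).le]
    refine (Real.exp_le_exp.2 ?_).trans (exp_abs_le_two_mul_cosh (t * x))
    rw [abs_mul]
    gcongr
  have hsum := hasSum_integral_of_dominated_convergence (μ := μ)
    (F := fun (k : ℕ) (x : ℝ) ↦ (z * x) ^ k / (k.factorial : ℂ))
    (f := fun x : ℝ ↦ Complex.exp (z * x))
    (fun (k : ℕ) x ↦ (‖z‖ * |x|) ^ k / (k.factorial : ℝ))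
    (fun k ↦ by fun_prop)
    (fun k ↦ .of_forall fun x ↦ by
      rw [norm_div, norm_pow, norm_mul, Complex.norm_real, Real.norm_eq_abs, Complex.norm_natCast])
    (.of_forall fun x ↦ Real.summable_pow_div_factorial _)
    (by simpa only [Real.exp_eq_exp_ℝ, NormedSpace.exp_eq_tsum_div] using hexp)
    (.of_forall fun x ↦ by
      rw [Complex.exp_eq_exp_ℂ]
      exact NormedSpace.expSeries_div_hasSum_exp _)
  convert! hsum using 2 with k
  rw [← integral_complex_ofReal, ← integral_const_mul]
  congr 1 with x
  push_cast
  ring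

lemma analyticOnNhd_complexMGF_of_integrable_cosh
    (h : Integrable (fun x ↦ Real.cosh (t * x)) μ) :
    AnalyticOnNhd ℂ (complexMGF id μ) {z | z.re ∈ Set.Ioo (-|t|) |t|} :=
  analyticOnNhd_complexMGF.mono fun _ hz ↦ interior_maximal
    (fun _ hs ↦ integrable_exp_mul_of_integrable_cosh h (abs_lt.2 hs).le) isOpen_Ioo hz

lemma eq_of_moments_eq_of_integrable_cosh [IsFiniteMeasure μ] [IsFiniteMeasure ν] (ht : t ≠ 0)
    (h : Integrable (fun x ↦ Real.cosh (t * x)) μ)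
    (hν : ∀ d : ℕ, Integrable (fun x : ℝ ↦ x ^ d) ν)
    (hm : ∀ d : ℕ, ∫ x, x ^ d ∂ν = ∫ x, x ^ d ∂μ) : ν = μ := by
  have hcosh := integrable_cosh_of_moments_eq ht h hν hm
  have hlocal : complexMGF id ν =ᶠ[𝓝 0] complexMGF id μ := by
    filter_upwards [Metric.ball_mem_nhds 0 (abs_pos.2 ht)] with z hz
    have hz' : ‖z‖ ≤ |t| := (mem_ball_zero_iff.1 hz).le
    have hsum := hasSum_complexMGF_of_integrable_cosh hcosh hz'
    simp_rw [hm] at hsum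
    exact hsum.unique (hasSum_complexMGF_of_integrable_cosh h hz')
  have hstrip : IsPreconnected {z : ℂ | z.re ∈ Set.Ioo (-|t|) |t|} :=
    ((convex_Ioo _ _).linear_preimage Complex.reLm).isPreconnected
  have hzero : (0 : ℝ) ∈ Set.Ioo (-|t|) |t| := by simpa using ht
  have heq : Set.EqOn (complexMGF id ν) (complexMGF id μ) {z : ℂ | z.re ∈ Set.Ioo (-|t|) |t|} :=
    (analyticOnNhd_complexMGF_of_integrable_cosh hcosh).eqOn_of_preconnected_of_eventuallyEq
      (analyticOnNhd_complexMGF_of_integrable_cosh h) hstrip hzero hlocal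
  refine Measure.ext_of_charFun (funext fun ξ ↦ ?_)
  rw [← complexMGF_id_mul_I, ← complexMGF_id_mul_I]
  exact heq (by simpa using ht)

end ExponentialMoments

section Moments

variable {Ω : Type*} [MeasurableSpace Ω] {P : Measure Ω} {Y : Ω → ℝ} {t : ℝ}

lemma integral_pow_map_eq_moment (hY : AEMeasurable Y P) (d : ℕ) :
    ∫ x, x ^ d ∂P.map Y = moment Y d P :=
  integral_map (f := fun x ↦ x ^ d) hY (by fun_prop)

lemma isDeterminedByMoments_of_integrable_cosh [IsFiniteMeasure P] (hY : AEMeasurable Y P)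
    (ht : t ≠ 0) (h : Integrable (fun ω ↦ Real.cosh (t * Y ω)) P) : IsDeterminedByMoments Y P := by
  have hlaw : Integrable (fun x ↦ Real.cosh (t * x)) (P.map Y) :=
    (integrable_map_measure (by fun_prop) hY).2 h
  refine ⟨fun d ↦ (integrable_map_measure (g := fun x ↦ x ^ d) (by fun_prop) hY).1
    (integrable_pow_of_integrable_cosh ht hlaw d), fun ν _ hν ↦ ?_⟩
  refine eq_of_moments_eq_of_integrable_cosh ht hlaw (fun d ↦ (hν d).1) fun d ↦ ?_
  rw [(hν d).2, integral_pow_map_eq_moment hY]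

end Moments

section TendstoInDistribution

variable {ι : Type*} {l : Filter ι} [l.NeBot] {Ω : ι → Type*} [∀ i, MeasurableSpace (Ω i)]
  {P : ∀ i, Measure (Ω i)} [∀ i, IsProbabilityMeasure (P i)] {Ω' : Type*} [MeasurableSpace Ω']
  {P' : Measure Ω'} [IsProbabilityMeasure P'] {X : ∀ i, Ω i → ℝ} {Z : Ω' → ℝ} {t B : ℝ}

lemma isDeterminedByMoments_of_tendstoInDistribution (hZ : TendstoInDistribution X l Z P P')
    (ht : t ≠ 0) (hint : ∀ i, Integrable (fun ω ↦ Real.cosh (t * X i ω)) (P i))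
    (hB : ∀ i, ∫ ω, Real.cosh (t * X i ω) ∂P i ≤ B) : IsDeterminedByMoments Z P' := by
  obtain ⟨hX, hZm, hlim⟩ := hZ
  refine isDeterminedByMoments_of_integrable_cosh hZm ht
    ((integrable_map_measure (g := fun x ↦ Real.cosh (t * x)) (by fun_prop) hZm).1
      (integrable_and_integral_le_of_tendsto (B := B) hlim (by fun_prop)
        (fun x ↦ (Real.cosh_pos _).le) (fun i ↦ ?_) fun i ↦ ?_).1)
  · exact (integrable_map_measure (by fun_prop) (hX i)).2 (hint i)
  · rw [ProbabilityMeasure.coe_mk, integral_map (hX i) (by fun_prop)]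
    exact hB i

lemma tendsto_moment_of_tendstoInDistribution (hZ : TendstoInDistribution X l Z P P')
    (ht : t ≠ 0) (hint : ∀ i, Integrable (fun ω ↦ Real.cosh (t * X i ω)) (P i))
    (hB : ∀ i, ∫ ω, Real.cosh (t * X i ω) ∂P i ≤ B) (d : ℕ) :
    Tendsto (fun i ↦ moment (X i) d (P i)) l (𝓝 (moment Z d P')) := by
  obtain ⟨hX, hZm, hlim⟩ := hZ
  have hlaw (i : ι) : Integrable (fun x ↦ Real.cosh (t * x)) ((P i).map (X i)) :=
    (integrable_map_measure (by fun_prop) (hX i)).2 (hint i)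
  have hsq (i : ι) : ∫ x, (x ^ d) ^ 2 ∂(P i).map (X i) ≤
      (2 * d).factorial / t ^ (2 * d) * B := by
    simp_rw [← pow_mul, mul_comm d 2]
    refine (integral_pow_two_mul_le ht (hlaw i) d).trans ?_
    rw [integral_map (hX i) (by fun_prop)]
    have := (even_two_mul d).pow_nonneg t
    gcongr
    exact hB i
  have hsqint (i : ι) : Integrable (fun x ↦ (x ^ d) ^ 2) ((P i).map (X i)) := by
    simp_rw [← pow_mul]
    exact integrable_pow_of_integrable_cosh ht (hlaw i) (d * 2)
  simpa only [ProbabilityMeasure.coe_mk, integral_pow_map_eq_moment (hX _),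
    integral_pow_map_eq_moment hZm] using
    tendsto_integral_of_integral_sq_le hlim (g := fun x ↦ x ^ d) (by fun_prop) hsqint hsq

end TendstoInDistribution

/-! ### Polynomials whose roots are zero or lie on the unit circle -/

section Roots

/-- The contribution of the root `z` of `f` to the mean `f'(1) / f(1)` of the distribution with
generating function `f`: it is `1` for `z = 0` and `1 / 2` for `z` on the unit circle. -/
noncomputable def rootMean (z : ℂ) : ℝ := 1 - ‖z‖ / 2

/-- The contribution of the root `z` of `f` to the variance of the distribution with generating
function `f`: it is `0` for `z = 0` and `1 / |1 - z|²` for `z` on the unit circle. -/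
noncomputable def rootVariance (z : ℂ) : ℝ := ‖z‖ / ‖1 - z‖ ^ 2

/-- The polynomial `Q` such that the square of the centered moment generating function of the
distribution with generating function `f` is `Q(cosh s - 1)`, in terms of the roots of `f`. -/
noncomputable def dispersionPolynomial (R : Multiset ℂ) : ℝ[X] :=
  (R.map fun z ↦ 1 + C (2 * rootVariance z) * X).prod

variable {z : ℂ} {R : Multiset ℂ} {g : ℂ[X]}

lemma rootVariance_nonneg (z : ℂ) : 0 ≤ rootVariance z := by
  unfold rootVariance
  positivity

lemma rootVariance_eq_zero_or_ge (hz : z = 0 ∨ ‖z‖ = 1) (hz1 : z ≠ 1) :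
    rootVariance z = 0 ∨ 1 / 4 ≤ rootVariance z := by
  obtain rfl | hz := hz
  · simp [rootVariance]
  · right
    have hpos : 0 < ‖1 - z‖ := norm_pos_iff.2 (sub_ne_zero.2 hz1.symm)
    have hle : ‖1 - z‖ ≤ 2 := (norm_sub_le 1 z).trans (by rw [norm_one, hz]; norm_num)
    rw [rootVariance, hz]
    gcongr
    nlinarith

lemma sum_rootVariance_eq_zero_or_ge (hR : ∀ z ∈ R, (z = 0 ∨ ‖z‖ = 1) ∧ z ≠ 1) :
    (R.map rootVariance).sum = 0 ∨ 1 / 4 ≤ (R.map rootVariance).sum := by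
  by_cases! h : ∀ z ∈ R, rootVariance z = 0
  · exact .inl (Multiset.sum_eq_zero (by simpa using h))
  · obtain ⟨z, hz, hne⟩ := h
    refine .inr (((rootVariance_eq_zero_or_ge (hR z hz).1 (hR z hz).2).resolve_left hne).trans ?_)
    refine Multiset.single_le_sum (fun x hx ↦ ?_) _ (Multiset.mem_map_of_mem _ hz)
    obtain ⟨y, -, rfl⟩ := Multiset.mem_map.1 hx
    exact rootVariance_nonneg y

lemma eval_dispersionPolynomial (R : Multiset ℂ) (u : ℝ) :
    (dispersionPolynomial R).eval u = (R.map fun z ↦ 1 + 2 * rootVariance z * u).prod := by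
  rw [dispersionPolynomial, eval_multiset_prod, Multiset.map_map]
  simp

lemma eval_zero_dispersionPolynomial (R : Multiset ℂ) : (dispersionPolynomial R).eval 0 = 1 := by
  simp [eval_dispersionPolynomial]

lemma eval_zero_derivative_dispersionPolynomial (R : Multiset ℂ) :
    (dispersionPolynomial R).derivative.eval 0 = 2 * (R.map rootVariance).sum := by
  induction R using Multiset.induction_on with
  | empty => simp [dispersionPolynomial]
  | cons z R ih =>
    rw [dispersionPolynomial, Multiset.map_cons, Multiset.prod_cons, ← dispersionPolynomial,
      derivative_mul]
    simp [ih, eval_zero_dispersionPolynomial, mul_add]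

lemma eval_dispersionPolynomial_le_exp (R : Multiset ℂ) {u : ℝ} (hu : 0 ≤ u) :
    (dispersionPolynomial R).eval u ≤ Real.exp (2 * ((R.map rootVariance).sum * u)) := by
  have hexp : Real.exp (2 * ((R.map rootVariance).sum * u)) =
      (R.map fun z ↦ Real.exp (2 * rootVariance z * u)).prod := by
    rw [← Multiset.sum_map_mul_right, ← Multiset.sum_map_mul_left, Real.exp_multiset_sum,
      Multiset.map_map]
    simp only [Function.comp_def, mul_assoc]
  rw [eval_dispersionPolynomial, hexp]
  refine Multiset.prod_map_le_prod_map₀ _ _ (fun z _ ↦ ?_) fun z _ ↦ ?_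
  · have := rootVariance_nonneg z
    positivity
  · rw [add_comm]
    exact Real.add_one_le_exp _

lemma norm_exp_sub_sq (hz : z = 0 ∨ ‖z‖ = 1) (hz1 : z ≠ 1) (s : ℝ) :
    ‖(Real.exp s : ℂ) - z‖ ^ 2 = ‖1 - z‖ ^ 2 *
      (Real.exp (2 * (s * rootMean z)) * (1 + 2 * rootVariance z * (Real.cosh s - 1))) := by
  obtain rfl | hz := hz
  · simp [rootMean, rootVariance, ← Real.exp_nat_mul, -Complex.ofReal_exp]
  · have hne : ‖1 - z‖ ≠ 0 := norm_ne_zero_iff.2 (sub_ne_zero.2 hz1.symm)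
    have hnormSq (r : ℝ) : ‖(r : ℂ) - z‖ ^ 2 = r ^ 2 + 1 - 2 * r * z.re := by
      rw [Complex.sq_norm, Complex.normSq_sub, Complex.normSq_ofReal, ← Complex.sq_norm, hz]
      simp
      ring
    have hcosh : Real.exp s ^ 2 + 1 = 2 * Real.exp s * Real.cosh s := by
      rw [Real.cosh_eq, Real.exp_neg]
      field_simp
    have hmean : Real.exp (2 * (s * rootMean z)) = Real.exp s := by
      rw [rootMean, hz]
      congr 1
      ring
    calc ‖(Real.exp s : ℂ) - z‖ ^ 2
        = Real.exp s * (‖1 - z‖ ^ 2 + 2 * (Real.cosh s - 1)) := by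
          have h1 := hnormSq 1
          rw [Complex.ofReal_one] at h1
          rw [hnormSq, hcosh, h1]
          ring
      _ = _ := by
          rw [hmean, rootVariance, hz]
          field_simp

lemma norm_eval_exp_sq (hg : ∀ z ∈ g.roots, (z = 0 ∨ ‖z‖ = 1) ∧ z ≠ 1) (s : ℝ) :
    ‖g.eval (Real.exp s : ℂ)‖ ^ 2 = ‖g.eval 1‖ ^ 2 *
      (Real.exp (2 * (s * (g.roots.map rootMean).sum)) *
        (dispersionPolynomial g.roots).eval (Real.cosh s - 1)) := by
  have hprod (w : ℂ) : ‖g.eval w‖ ^ 2 =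
      ‖g.leadingCoeff‖ ^ 2 * (g.roots.map fun z ↦ ‖w - z‖ ^ 2).prod := by
    rw [(IsAlgClosed.splits g).eval_eq_prod_roots, norm_mul, mul_pow, Multiset.prod_map_pow]
    congr 2
    exact (map_multiset_prod (normHom (α := ℂ)) _).trans (by rw [Multiset.map_map]; rfl)
  have hexp : Real.exp (2 * (s * (g.roots.map rootMean).sum)) =
      (g.roots.map fun z ↦ Real.exp (2 * (s * rootMean z))).prod := by
    rw [← Multiset.sum_map_mul_left, ← Multiset.sum_map_mul_left, Real.exp_multiset_sum,
      Multiset.map_map]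
    rfl
  rw [hprod, hprod, hexp, eval_dispersionPolynomial, mul_assoc, ← Multiset.prod_map_mul,
    ← Multiset.prod_map_mul]
  exact congrArg _ (congrArg _ (Multiset.map_congr rfl fun z hz ↦
    norm_exp_sub_sq (hg z hz).1 (hg z hz).2 s))

end Roots

/-! ### Mean and variance from the moment generating function -/

section CumulantGeneratingFunction

variable {c : ℝ} {Q : ℝ[X]} {Ω : Type*} [MeasurableSpace Ω] {μ : Measure Ω}
  [IsProbabilityMeasure μ] {Y : Ω → ℝ}

lemma eval_cosh_sub_one_ne_zero_of_mgf_sq_eq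
    (hint : ∀ s, Integrable (fun ω ↦ Real.exp (s * Y ω)) μ)
    (h : ∀ s, mgf Y μ s ^ 2 = Real.exp (2 * (s * c)) * Q.eval (Real.cosh s - 1)) (s : ℝ) :
    Q.eval (Real.cosh s - 1) ≠ 0 :=
  right_ne_zero_of_mul ((h s).symm.trans_ne (pow_pos (mgf_pos (hint s)) 2).ne')

lemma cgf_eq_of_mgf_sq_eq (hint : ∀ s, Integrable (fun ω ↦ Real.exp (s * Y ω)) μ)
    (h : ∀ s, mgf Y μ s ^ 2 = Real.exp (2 * (s * c)) * Q.eval (Real.cosh s - 1)) :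
    cgf Y μ = fun s ↦ s * c + Real.log (Q.eval (Real.cosh s - 1)) / 2 := by
  funext s
  have hlog := congrArg Real.log (h s)
  have hQ := eval_cosh_sub_one_ne_zero_of_mgf_sq_eq hint h s
  rw [Real.log_pow, Real.log_mul (Real.exp_ne_zero _) hQ, Real.log_exp, Nat.cast_two] at hlog
  rw [cgf]
  linarith

lemma deriv_cgf_eq_of_mgf_sq_eq (hint : ∀ s, Integrable (fun ω ↦ Real.exp (s * Y ω)) μ)
    (h : ∀ s, mgf Y μ s ^ 2 = Real.exp (2 * (s * c)) * Q.eval (Real.cosh s - 1)) :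
    deriv (cgf Y μ) = fun s ↦ c + Q.derivative.eval (Real.cosh s - 1) * Real.sinh s /
      Q.eval (Real.cosh s - 1) / 2 := by
  funext s
  have hQ := eval_cosh_sub_one_ne_zero_of_mgf_sq_eq hint h s
  have hcomp : HasDerivAt (fun s ↦ Q.eval (Real.cosh s - 1))
      (Q.derivative.eval (Real.cosh s - 1) * Real.sinh s) s :=
    (Q.hasDerivAt _).comp s ((Real.hasDerivAt_cosh s).sub_const 1)
  rw [cgf_eq_of_mgf_sq_eq hint h]
  exact ((((hasDerivAt_id' s).mul_const c).add ((hcomp.log hQ).div_const 2)).congr_deriv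
    (by rw [one_mul])).deriv

lemma integral_eq_of_mgf_sq_eq (hint : ∀ s, Integrable (fun ω ↦ Real.exp (s * Y ω)) μ)
    (h : ∀ s, mgf Y μ s ^ 2 = Real.exp (2 * (s * c)) * Q.eval (Real.cosh s - 1)) :
    μ[Y] = c := by
  have huniv : integrableExpSet Y μ = Set.univ := Set.eq_univ_of_forall hint
  have hderiv := deriv_cgf_zero (X := Y) (μ := μ) (by simp [huniv])
  rw [deriv_cgf_eq_of_mgf_sq_eq hint h] at hderiv
  simpa using hderiv.symm

lemma variance_eq_of_mgf_sq_eq (hint : ∀ s, Integrable (fun ω ↦ Real.exp (s * Y ω)) μ)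
    (h : ∀ s, mgf Y μ s ^ 2 = Real.exp (2 * (s * c)) * Q.eval (Real.cosh s - 1))
    (hQ : Q.eval 0 = 1) : Var[Y; μ] = Q.derivative.eval 0 / 2 := by
  have huniv : integrableExpSet Y μ = Set.univ := Set.eq_univ_of_forall hint
  have hcosh (q : ℝ[X]) : DifferentiableAt ℝ (fun s ↦ q.eval (Real.cosh s - 1)) 0 :=
    q.differentiable.comp (by fun_prop) 0
  have hderiv : HasDerivAt (deriv (cgf Y μ)) (Q.derivative.eval 0 / 2) 0 := by
    rw [deriv_cgf_eq_of_mgf_sq_eq hint h]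
    convert! (((((hcosh Q.derivative).hasDerivAt.mul (Real.hasDerivAt_sinh 0)).div
      (hcosh Q).hasDerivAt (by simp [hQ])).div_const 2).const_add c) using 1
    simp [hQ]
  have hvar := variance_tilted_mul (X := Y) (μ := μ) (t := 0) (by simp [huniv])
  simpa only [iteratedDeriv_succ, iteratedDeriv_zero, hderiv.deriv, zero_mul, tilted_const,
    measure_univ, inv_one, one_smul] using hvar

end CumulantGeneratingFunction

/-! ### Random variables corresponding to polynomials -/

section CorrespondsTo

variable {f : ℕ[X]} {Ω : Type*} [MeasurableSpace Ω] {μ : Measure Ω} [IsProbabilityMeasure μ]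
  {Y : Ω → ℝ}

lemma eval_one_pos_of_ne_zero (hf : f ≠ 0) : 0 < f.eval 1 := by
  rw [eval_eq_sum, Polynomial.sum]
  simp only [one_pow, mul_one]
  exact Finset.sum_pos (fun k hk ↦ Nat.pos_of_ne_zero (mem_support_iff.1 hk))
    (support_nonempty.2 hf)

lemma CorrespondsTo.integrable_and_integral_eq (h : CorrespondsTo Y f μ) (hf : f ≠ 0)
    (g : ℝ → ℝ) :
    Integrable (fun ω ↦ g (Y ω)) μ ∧
      ∫ ω, g (Y ω) ∂μ = ∑ k ∈ f.support, (f.coeff k : ℝ) / (f.eval 1 : ℕ) * g k := by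
  obtain ⟨hY, h⟩ := h
  set ν := μ.map Y
  have : IsProbabilityMeasure ν := Measure.isProbabilityMeasure_map hY
  have hν (k : ℕ) : ν.real {(k : ℝ)} = (f.coeff k : ℝ) / (f.eval 1 : ℕ) := by
    rw [← h k, map_measureReal_apply_of_aemeasurable hY (measurableSet_singleton _)]
    rfl
  set S : Finset ℝ := f.support.map Nat.castEmbedding
  have hS : ν.real S = 1 := by
    have hpos : ((f.eval 1 : ℕ) : ℝ) ≠ 0 := mod_cast (eval_one_pos_of_ne_zero hf).ne'
    rw [← sum_measureReal_singleton, Finset.sum_map]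
    simp only [Nat.castEmbedding_apply, hν]
    rw [← Finset.sum_div, div_eq_one_iff_eq hpos, eval_eq_sum, Polynomial.sum]
    simp
  have hres : ν.restrict S = ν := by
    refine Measure.restrict_eq_self_of_ae_mem ((mem_ae_iff_prob_eq_one S.measurableSet).2 ?_)
    rwa [measureReal_def, ENNReal.toReal_eq_one_iff] at hS
  have hint : Integrable g ν := by
    rw [← hres]
    exact IntegrableOn.finset
  refine ⟨hint.comp_aemeasurable hY, ?_⟩
  rw [← integral_map hY hint.aestronglyMeasurable]
  change ∫ x, g x ∂ν = _
  rw [← hres, setIntegral_finset S IntegrableOn.finset, Finset.sum_map]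
  simp only [Nat.castEmbedding_apply, hν, smul_eq_mul]

lemma CorrespondsTo.integrable_exp (h : CorrespondsTo Y f μ) (hf : f ≠ 0) (s : ℝ) :
    Integrable (fun ω ↦ Real.exp (s * Y ω)) μ :=
  (h.integrable_and_integral_eq hf fun x ↦ Real.exp (s * x)).1

lemma CorrespondsTo.mgf_eq (h : CorrespondsTo Y f μ) (hf : f ≠ 0) (s : ℝ) :
    mgf Y μ s = aeval (Real.exp s) f / (f.eval 1 : ℕ) := by
  rw [mgf, (h.integrable_and_integral_eq hf fun x ↦ Real.exp (s * x)).2, aeval_def, eval₂_eq_sum,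
    Polynomial.sum, Finset.sum_div]
  refine Finset.sum_congr rfl fun k _ ↦ ?_
  rw [← Real.exp_nat_mul, mul_comm (k : ℝ), div_mul_eq_mul_div]
  rfl

lemma zero_or_norm_eq_one_and_ne_one_of_mem_roots (hf : f ≠ 0)
    (hroot : ∀ z : ℂ, aeval z f = 0 → z = 0 ∨ ‖z‖ = 1) :
    ∀ z ∈ (f.map (algebraMap ℕ ℂ)).roots, (z = 0 ∨ ‖z‖ = 1) ∧ z ≠ 1 := by
  intro z hz
  have hz0 := isRoot_of_mem_roots hz
  refine ⟨hroot z (by rwa [IsRoot, eval_map_algebraMap] at hz0), ?_⟩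
  rintro rfl
  rw [IsRoot, eval_one_map, eq_natCast] at hz0
  exact (eval_one_pos_of_ne_zero hf).ne' (mod_cast hz0)

lemma CorrespondsTo.mgf_sq_eq (h : CorrespondsTo Y f μ) (hf : f ≠ 0)
    (hroot : ∀ z : ℂ, aeval z f = 0 → z = 0 ∨ ‖z‖ = 1) (s : ℝ) :
    mgf Y μ s ^ 2 =
      Real.exp (2 * (s * ((f.map (algebraMap ℕ ℂ)).roots.map rootMean).sum)) *
        (dispersionPolynomial (f.map (algebraMap ℕ ℂ)).roots).eval (Real.cosh s - 1) := by
  have hpos : ((f.eval 1 : ℕ) : ℝ) ≠ 0 := mod_cast (eval_one_pos_of_ne_zero hf).ne'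
  have hreal :
      ‖(f.map (algebraMap ℕ ℂ)).eval (Real.exp s : ℂ)‖ ^ 2 = aeval (Real.exp s) f ^ 2 := by
    rw [eval_map_algebraMap, ← Complex.coe_algebraMap, aeval_algebraMap_apply,
      Complex.coe_algebraMap, Complex.norm_real, Real.norm_eq_abs, sq_abs]
  rw [h.mgf_eq hf, div_pow, ← hreal,
    norm_eval_exp_sq (zero_or_norm_eq_one_and_ne_one_of_mem_roots hf hroot), eval_one_map,
    eq_natCast, Complex.norm_natCast, mul_div_cancel_left₀ _ (pow_ne_zero 2 hpos)]

lemma CorrespondsTo.integral_eq (h : CorrespondsTo Y f μ) (hf : f ≠ 0)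
    (hroot : ∀ z : ℂ, aeval z f = 0 → z = 0 ∨ ‖z‖ = 1) :
    μ[Y] = ((f.map (algebraMap ℕ ℂ)).roots.map rootMean).sum :=
  integral_eq_of_mgf_sq_eq (h.integrable_exp hf) (h.mgf_sq_eq hf hroot)

lemma CorrespondsTo.variance_eq (h : CorrespondsTo Y f μ) (hf : f ≠ 0)
    (hroot : ∀ z : ℂ, aeval z f = 0 → z = 0 ∨ ‖z‖ = 1) :
    Var[Y; μ] = ((f.map (algebraMap ℕ ℂ)).roots.map rootVariance).sum := by
  rw [variance_eq_of_mgf_sq_eq (h.integrable_exp hf) (h.mgf_sq_eq hf hroot)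
    (eval_zero_dispersionPolynomial _), eval_zero_derivative_dispersionPolynomial,
    mul_div_cancel_left₀ _ two_ne_zero]

lemma CorrespondsTo.variance_eq_zero_or_ge (h : CorrespondsTo Y f μ) (hf : f ≠ 0)
    (hroot : ∀ z : ℂ, aeval z f = 0 → z = 0 ∨ ‖z‖ = 1) :
    Var[Y; μ] = 0 ∨ 1 / 4 ≤ Var[Y; μ] := by
  rw [h.variance_eq hf hroot]
  exact sum_rootVariance_eq_zero_or_ge (zero_or_norm_eq_one_and_ne_one_of_mem_roots hf hroot)

lemma CorrespondsTo.mgf_le (h : CorrespondsTo Y f μ) (hf : f ≠ 0)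
    (hroot : ∀ z : ℂ, aeval z f = 0 → z = 0 ∨ ‖z‖ = 1) (s : ℝ) :
    mgf Y μ s ≤ Real.exp (s * μ[Y] + Var[Y; μ] * (Real.cosh s - 1)) := by
  refine le_of_sq_le_sq ?_ (Real.exp_pos _).le
  rw [← Real.exp_nat_mul, Nat.cast_two, mul_add, Real.exp_add, h.integral_eq hf hroot,
    h.variance_eq hf hroot, h.mgf_sq_eq hf hroot]
  gcongr
  exact eval_dispersionPolynomial_le_exp _ (sub_nonneg.2 (Real.one_le_cosh s))

end CorrespondsTo

section Standardize

variable {Ω : Type*} [MeasurableSpace Ω] {μ : Measure Ω} {Y : Ω → ℝ} {v : ℝ}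

lemma mgf_standardize (Y : Ω → ℝ) (μ : Measure Ω) (t : ℝ) :
    mgf (standardize Y μ) μ t =
      mgf Y μ (t / √Var[Y; μ]) * Real.exp (-(t / √Var[Y; μ] * μ[Y])) := by
  have hlinear : standardize Y μ =
      fun ω ↦ (√Var[Y; μ])⁻¹ * Y ω + -((√Var[Y; μ])⁻¹ * μ[Y]) := by
    funext ω
    rw [standardize]
    ring
  rw [hlinear, mgf_add_const, mgf_const_mul]
  ring_nf

lemma cosh_mul_sub_one_le {r : ℝ} (hr : |r| ≤ 1) (x : ℝ) :
    Real.cosh (r * x) - 1 ≤ r ^ 2 * (Real.cosh x - 1) := by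
  have hr2 : r ^ 2 ≤ 1 := (sq_le_one_iff_abs_le_one r).2 hr
  suffices Real.cosh (r * x) - r ^ 2 * Real.cosh x ≤ 1 - r ^ 2 by linarith
  refine hasSum_le (fun k ↦ ?_)
    ((Real.hasSum_cosh (r * x)).sub ((Real.hasSum_cosh x).mul_left (r ^ 2)))
    (hasSum_ite_eq 0 (1 - r ^ 2))
  obtain rfl | hk := eq_or_ne k 0
  · simp
  · rw [if_neg hk, sub_nonpos, mul_pow, ← mul_div_assoc]
    have hx : 0 ≤ x ^ (2 * k) := (even_two_mul k).pow_nonneg x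
    refine div_le_div_of_nonneg_right (mul_le_mul_of_nonneg_right ?_ hx) (by positivity)
    rw [pow_mul]
    exact pow_le_of_le_one (sq_nonneg r) hr2 hk

lemma mul_cosh_div_sqrt_sub_one_le (hv : v = 0 ∨ 1 / 4 ≤ v) (t : ℝ) :
    v * (Real.cosh (t / √v) - 1) ≤ (Real.cosh (2 * t) - 1) / 4 := by
  obtain rfl | hv := hv
  · rw [zero_mul]
    linarith [Real.one_le_cosh (2 * t)]
  · have hv0 : 0 < v := by linarith
    have hr : |(2 * √v)⁻¹| ≤ 1 := by
      rw [abs_of_nonneg (by positivity)]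
      refine inv_le_one_of_one_le₀ ?_
      linarith [Real.le_sqrt_of_sq_le (by linarith : (1 / 2 : ℝ) ^ 2 ≤ v)]
    calc v * (Real.cosh (t / √v) - 1)
        = v * (Real.cosh ((2 * √v)⁻¹ * (2 * t)) - 1) := by
          congr 3
          field_simp
      _ ≤ v * ((2 * √v)⁻¹ ^ 2 * (Real.cosh (2 * t) - 1)) := by
          gcongr
          exact cosh_mul_sub_one_le hr _
      _ = (Real.cosh (2 * t) - 1) / 4 := by
          rw [inv_pow, mul_pow, Real.sq_sqrt hv0.le]
          field_simp
          ring

variable {f : ℕ[X]} [IsProbabilityMeasure μ]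

lemma CorrespondsTo.mgf_standardize_le (h : CorrespondsTo Y f μ) (hf : f ≠ 0)
    (hroot : ∀ z : ℂ, aeval z f = 0 → z = 0 ∨ ‖z‖ = 1) (t : ℝ) :
    mgf (standardize Y μ) μ t ≤ Real.exp ((Real.cosh (2 * t) - 1) / 4) := by
  refine le_trans ?_ (Real.exp_le_exp.2
    (mul_cosh_div_sqrt_sub_one_le (h.variance_eq_zero_or_ge hf hroot) t))
  rw [mgf_standardize, Real.exp_neg, ← div_eq_mul_inv, div_le_iff₀' (Real.exp_pos _),
    ← Real.exp_add]
  exact h.mgf_le hf hroot _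

lemma CorrespondsTo.integrable_comp_standardize (h : CorrespondsTo Y f μ) (hf : f ≠ 0)
    (g : ℝ → ℝ) : Integrable (fun ω ↦ g (standardize Y μ ω)) μ :=
  (h.integrable_and_integral_eq hf fun y ↦ g ((y - ∫ ω, Y ω ∂μ) / √Var[Y; μ])).1

lemma CorrespondsTo.integral_cosh_standardize_le (h : CorrespondsTo Y f μ) (hf : f ≠ 0)
    (hroot : ∀ z : ℂ, aeval z f = 0 → z = 0 ∨ ‖z‖ = 1) (t : ℝ) :
    ∫ ω, Real.cosh (t * standardize Y μ ω) ∂μ ≤ Real.exp ((Real.cosh (2 * t) - 1) / 4) := by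
  have hcosh : ∫ ω, Real.cosh (t * standardize Y μ ω) ∂μ =
      (mgf (standardize Y μ) μ t + mgf (standardize Y μ) μ (-t)) / 2 := by
    simp_rw [Real.cosh_eq, ← neg_mul]
    rw [integral_div, integral_add (h.integrable_comp_standardize hf fun y ↦ Real.exp (t * y))
      (h.integrable_comp_standardize hf fun y ↦ Real.exp (-t * y)), mgf, mgf]
  have hpos := h.mgf_standardize_le hf hroot t
  have hneg := h.mgf_standardize_le hf hroot (-t)
  rw [mul_neg, Real.cosh_neg] at hneg
  rw [hcosh]
  linarith

end Standardize

theorem theorem5p2_general {ι : Type*} {l : Filter ι} [l.NeBot] {Ω : ι → Type*}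
    [∀ i, MeasurableSpace (Ω i)] (P : ∀ i, Measure (Ω i)) [∀ i, IsProbabilityMeasure (P i)]
    {Ω' : Type*} [MeasurableSpace Ω'] (P' : Measure Ω') [IsProbabilityMeasure P'] (f : ι → ℕ[X])
    (X : ∀ i, Ω i → ℝ) (Z : Ω' → ℝ) (hf : ∀ i, f i ≠ 0)
    (hroot : ∀ i, ∀ z : ℂ, aeval z (f i) = 0 → z = 0 ∨ ‖z‖ = 1)
    (hX : ∀ i, CorrespondsTo (X i) (f i) (P i))
    (hZ : TendstoInDistribution (fun i ↦ standardize (X i) (P i)) l Z P P') :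
    IsDeterminedByMoments Z P' ∧
      ∀ d : ℕ, Tendsto (fun i ↦ moment (standardize (X i) (P i)) d (P i)) l
        (𝓝 (moment Z d P')) := by
  have hint (i : ι) := (hX i).integrable_comp_standardize (hf i) fun y ↦ Real.cosh (1 * y)
  have hB (i : ι) := (hX i).integral_cosh_standardize_le (hf i) (hroot i) 1
  exact ⟨isDeterminedByMoments_of_tendstoInDistribution hZ one_ne_zero hint hB,
    tendsto_moment_of_tendstoInDistribution hZ one_ne_zero hint hB⟩

theorem theorem5p2 {Ω : ℕ → Type*} [∀ n, MeasurableSpace (Ω n)] (P : ∀ n, Measure (Ω n))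
    [∀ n, IsProbabilityMeasure (P n)] {Ω' : Type*} [MeasurableSpace Ω'] (P' : Measure Ω')
    [IsProbabilityMeasure P'] (f : ℕ → ℕ[X]) (X : ∀ n, Ω n → ℝ) (Z : Ω' → ℝ)
    (hf : ∀ n, IsCyclotomicGeneratingFunction (f n))
    (hX : ∀ n, CorrespondsTo (X n) (f n) (P n))
    (hZ : TendstoInDistribution (fun n ↦ standardize (X n) (P n)) atTop Z P P') :
    IsDeterminedByMoments Z P' ∧
      ∀ d : ℕ, 1 ≤ d →
        Tendsto (fun n ↦ moment (standardize (X n) (P n)) d (P n)) atTop (𝓝 (moment Z d P')) := by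
  have := theorem5p2_general P P' f X Z (fun n ↦ (hf n).1) (fun n z hz ↦ ((hf n).2 z hz).imp_right
    fun ⟨m, hm, hzm⟩ ↦ Complex.norm_eq_one_of_pow_eq_one hzm hm.ne') hX hZ
  exact ⟨this.1, fun d _ ↦ this.2 d⟩
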